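/- Write $\mathbb{N}=\{1,2,\dots\}$ and $\mathbb{T}=\mathbb{R}/\mathbb{Z}$. A system is a pair $(Y,S)$ consisting of a nonempty compact metric space $(Y,d_Y)$ and a continuous map $S:Y\to Y$. For $\epsilon>0$ let $$\mathfrak{R}_\epsilon(Y,S)=\{m\in\mathbb{N} : \inf_{y\in Y} d_Y(y,S^m y)<\epsilon\}$$ be its set of $\epsilon$-returns. A set $R\subseteq\mathbb{N}$ is a set of recurrence for $(Y,S)$ if $R\cap\mathfrak{R}_\epsilon(Y,S)\neq\emptyset$ for every $\epsilon>0$, and a set of Bohr recurrence if it is a set of recurrence for every rotation $x\mapsto x+\alpha$ of every finite-dimensional torus $\mathbb{T}^k$. A set $A\subseteq\mathbb{N}$ is a Bohr$_0$ set if there are $k\in\mathbb{N}$, $\alpha\in\mathbb{T}^k$ and $\delta>0$ with $\{n\in\mathbb{N} : \|n\alpha\|<\delta\}\subseteq A$, where $\|\cdot\|$ is the distance to $0$ on $\mathbb{T}^k$. The system $(Y,S)$ has Bohr$_0$ large returns if $\mathfrak{R}_\epsilon(Y,S)$ is a Bohr$_0$ set for every $\epsilon>0$. It is equicontinuous if the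 family $\{S^n : n\in\mathbb{N}\}$ is (uniformly) equicontinuous. **Theorem.** Let $(X,T)$ be an equicontinuous system, let $d\ge 1$, and let $h_1:X\to\mathbb{T}$ and $h_2,\dots,h_d:\mathbb{T}\to\mathbb{T}$ be continuous. Define $T_{\vec h}$ on $X\times\mathbb{T}^d$ by $$T_{\vec h}(x,t_1,\dots,t_d)=\big(Tx,\ t_1+h_1(x),\ t_2+h_2(t_1),\ \dots,\ t_d+h_d(t_{d-1})\big).$$ Then every set of Bohr recurrence is a set of recurrence for $(X\times\mathbb{T}^d,T_{\vec h})$; equivalently, $(X\times\mathbb{T}^d,T_{\vec h})$ has Bohr$_0$ large returns. (Neither property depends on which of the usual product metrics is used on $X\times\mathbb{T}^d$.) -/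

import Mathlib

/-- The set of `ε`-returns of the system `(Y, S)`: the positive integers `m` for which some point
`y` satisfies `dist y (S^m y) < ε` (equivalently, since `Y` is nonempty in all uses,
`inf_y dist y (S^m y) < ε`). -/
def epsReturns {Y : Type*} [MetricSpace Y] (S : Y → Y) (ε : ℝ) : Set ℕ+ :=
  {m | ∃ y : Y, dist y (S^[(m : ℕ)] y) < ε}

/-- `R` is a set of recurrence for the system `(Y, S)`: for every `ε > 0`, the set `R` contains an
`ε`-return time. -/
def IsSetOfRecurrenceFor {Y : Type*} [MetricSpace Y] (R : Set ℕ+) (S : Y → Y) : Prop :=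
  ∀ ε : ℝ, 0 < ε → (R ∩ epsReturns S ε).Nonempty

/-- `R` is a set of Bohr recurrence: a set of recurrence for every rotation `x ↦ x + α` of every
finite-dimensional torus. -/
def IsSetOfBohrRecurrence (R : Set ℕ+) : Prop :=
  ∀ (k : ℕ) (α : Fin k → UnitAddCircle),
    IsSetOfRecurrenceFor R (fun x : Fin k → UnitAddCircle => x + α)

/-- `A` is a Bohr₀ set: it contains `{n ≥ 1 : ‖n α‖ < δ}` for some `δ > 0` and some `α` in a
finite-dimensional torus. (On `UnitAddCircle` the norm is the distance to the nearest integer; on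
the torus it is the maximum over the coordinates. Replacing it by the sum or the Euclidean norm
only changes `δ`.) -/
def IsBohrZero (A : Set ℕ+) : Prop :=
  ∃ (k : ℕ) (α : Fin k → UnitAddCircle) (δ : ℝ), 0 < δ ∧ {n : ℕ+ | ‖(n : ℕ) • α‖ < δ} ⊆ A

/-- The system `(Y, S)` has Bohr₀ large returns. -/
def HasBohrZeroLargeReturns {Y : Type*} [MetricSpace Y] (S : Y → Y) : Prop :=
  ∀ ε : ℝ, 0 < ε → IsBohrZero (epsReturns S ε)

/-- The tower of skew products of height `d + 1` over `(X, T)`, on `X × 𝕋^(d+1)`: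
`(x, t 0, …, t d) ↦ (T x, t 0 + h₁ x, t 1 + h 0 (t 0), …, t d + h (d-1) (t (d-1)))`.
(The metric of `X × (Fin (d + 1) → UnitAddCircle)` is the maximum metric. It is Lipschitz
equivalent to the sum metric, so that `IsSetOfRecurrenceFor` and `HasBohrZeroLargeReturns`
mean the same for both.) -/
def skewTower {X : Type*} {d : ℕ} (T : X → X) (h₁ : X → UnitAddCircle)
    (h : Fin d → UnitAddCircle → UnitAddCircle) :
    X × (Fin (d + 1) → UnitAddCircle) → X × (Fin (d + 1) → UnitAddCircle) :=
  fun p => (T p.1, Fin.cons (p.2 0 + h₁ p.1) (fun i : Fin d => p.2 i.succ + h i (p.2 i.castSucc)))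

/-! Induct on the height of the tower, proving Bohr₀ large returns; Bohr₀ sets are closed under
intersection. The displacement in a new top coordinate is a sum of values of `h` along the orbit
below. Translating the coordinate just below by `t` commutes with the dynamics there, so it keeps
the return below and shifts every argument of `h` by the same `t`. By
`exists_forall_exists_sum_add_eq` some `t` makes the sum of `n` terms equal `n • c`, where `c`
depends on `h` alone: the integral of a real lift in degree zero, and `0` otherwise. Asking that `n
• c` be small costs one Bohr₀ condition.

At the base, `h₁` lives on `X` and no such translation is available. Bogoliubov's theorem for
colorings yields a point `y` whose almost periods contain Bohr₀ sets, so `a j = h₁ (T^[j] y)` is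
almost periodic in the same sense. In `isBohrZero_exists_norm_sum_lt`, the sums over windows of a
good length vary slowly with the starting point. Either all their real lifts are unbounded and sweep
the circle, or one bounded lift, of window length `q`, controls through its mean the windows whose
length is a multiple of `q`. -/

/-! ### Bohr₀ sets -/

theorem IsBohrZero.mono {A B : Set ℕ+} (hA : IsBohrZero A) (hAB : A ⊆ B) : IsBohrZero B := by
  obtain ⟨k, α, δ, hδ, h⟩ := hA
  exact ⟨k, α, δ, hδ, h.trans hAB⟩

theorem IsBohrZero.inter {A B : Set ℕ+} (hA : IsBohrZero A) (hB : IsBohrZero B) :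
    IsBohrZero (A ∩ B) := by
  obtain ⟨k, α, δ, hδ, h⟩ := hA
  obtain ⟨l, β, γ, hγ, h'⟩ := hB
  refine ⟨k + l, Fin.append α β, min δ γ, lt_min hδ hγ, fun n hn => ?_⟩
  rw [Set.mem_ofPred_eq, pi_norm_lt_iff (lt_min hδ hγ)] at hn
  constructor
  · refine h ((pi_norm_lt_iff hδ).2 fun i => ?_)
    have := hn (Fin.castAdd l i)
    simp only [Pi.smul_apply, Fin.append_left] at this
    exact this.trans_le (min_le_left _ _)
  · refine h' ((pi_norm_lt_iff hγ).2 fun i => ?_)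
    have := hn (Fin.natAdd k i)
    simp only [Pi.smul_apply, Fin.append_right] at this
    exact this.trans_le (min_le_right _ _)

theorem isBohrZero_norm_nsmul_lt (β : UnitAddCircle) {ε : ℝ} (hε : 0 < ε) :
    IsBohrZero {n : ℕ+ | ‖(n : ℕ) • β‖ < ε} := by
  refine ⟨1, fun _ => β, ε, hε, fun n hn => ?_⟩
  exact (pi_norm_lt_iff hε).1 hn 0

/-- Given a positive integer `q`, its multiples form a Bohr₀ set. -/
theorem isBohrZero_multiples (q : ℕ) (hq : 0 < q) : IsBohrZero {n : ℕ+ | q ∣ (n : ℕ)} := by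
  have hq' : (0 : ℝ) < q := by exact_mod_cast hq
  -- Rotation by `1/q` with radius `1/q`: the multiples of `1/q` this close to an integer are
  -- integers.
  refine (isBohrZero_norm_nsmul_lt (((q : ℝ)⁻¹ : ℝ) : UnitAddCircle) (inv_pos.2 hq')).mono ?_
  intro n hn
  rw [Set.mem_ofPred_eq, ← AddCircle.coe_nsmul, UnitAddCircle.norm_eq] at hn
  set r := round ((n : ℕ) • (q : ℝ)⁻¹) with hr
  have h1 : |((n : ℕ) : ℝ) - r * q| < 1 := by
    have : ((n : ℕ) : ℝ) - r * q = ((n : ℕ) • (q : ℝ)⁻¹ - r) * q := by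
      rw [nsmul_eq_mul]; field_simp
    rw [this, abs_mul, abs_of_pos hq']
    calc _ < (q : ℝ)⁻¹ * q := by gcongr
      _ = 1 := inv_mul_cancel₀ hq'.ne'
  have h2 : |((n : ℕ) : ℤ) - r * q| < 1 := by exact_mod_cast h1
  rw [Int.abs_lt_one_iff] at h2
  have h3 : (q : ℤ) ∣ ((n : ℕ) : ℤ) := ⟨r, by linarith⟩
  exact_mod_cast h3

theorem HasBohrZeroLargeReturns.isSetOfRecurrenceFor {Y : Type*} [MetricSpace Y] {S : Y → Y}
    (hS : HasBohrZeroLargeReturns S) {R : Set ℕ+} (hR : IsSetOfBohrRecurrence R) :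
    IsSetOfRecurrenceFor R S := by
  intro ε hε
  obtain ⟨k, α, δ, hδ, h⟩ := hS ε hε
  obtain ⟨n, hnR, x, hx⟩ := hR k α δ hδ
  refine ⟨n, hnR, h ?_⟩
  have : (fun x : Fin k → UnitAddCircle => x + α)^[(n : ℕ)] x = x + (n : ℕ) • α := by
    generalize (n : ℕ) = m
    induction m with
    | zero => simp
    | succ m ih => rw [Function.iterate_succ_apply', ih, succ_nsmul, add_assoc]
  rw [this, dist_comm, dist_eq_norm, add_sub_cancel_left] at hx
  exact hx

/-! ### Bogoliubov's theorem -/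

open scoped ComplexConjugate in
theorem AddChar.normSq_sum_eq {G : Type*} [AddCommGroup G] [Finite G] (A : Finset G)
    (ψ : AddChar G ℂ) :
    ((‖∑ a ∈ A, ψ a‖ ^ 2 : ℝ) : ℂ) = ∑ p ∈ A ×ˢ A, ψ (p.1 - p.2) := by
  rw [Complex.ofReal_pow, ← Complex.mul_conj', map_sum, Finset.sum_mul_sum, Finset.sum_product]
  refine Finset.sum_congr rfl fun a _ => Finset.sum_congr rfl fun c _ => ?_
  rw [sub_eq_add_neg, AddChar.map_add_eq_mul, AddChar.map_neg_eq_conj]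

theorem AddChar.sum_normSq_sum {G : Type*} [AddCommGroup G] [Fintype G] (A : Finset G) :
    ∑ ψ : AddChar G ℂ, ‖∑ a ∈ A, ψ a‖ ^ 2 = (Fintype.card G : ℝ) * A.card := by
  classical
  rw [← Complex.ofReal_inj, Complex.ofReal_sum]
  simp_rw [AddChar.normSq_sum_eq]
  rw [Finset.sum_comm]
  simp_rw [AddChar.sum_apply_eq_ite, sub_eq_zero]
  rw [Finset.sum_product]
  simp only [Finset.sum_ite_eq]
  rw [Finset.sum_congr rfl (fun x hx => if_pos hx)]
  simp [mul_comm]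

/-- The finite form of Bogoliubov's theorem: the characters that are large on `A` control the
sums of two elements of `A` up to differences. -/
theorem exists_add_eq_add_add_of_large_spectrum {G : Type*} [AddCommGroup G] [Fintype G]
    (A : Finset G) (hA : A.Nonempty) (K : ℕ) (hK : Fintype.card G ≤ K * A.card) :
    ∃ R : Finset (AddChar G ℂ), R.Nonempty ∧ R.card ≤ K ^ 2 ∧
      ∀ n : G, (∀ ψ ∈ R, 0 < (ψ n).re) →
        ∃ a ∈ A, ∃ b ∈ A, ∃ c ∈ A, ∃ d ∈ A, c + d = a + b + n := by
  classical
  set F : AddChar G ℂ → ℝ := fun ψ => ‖∑ a ∈ A, ψ a‖ ^ 2 with hF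
  have hF0 : ∀ ψ, 0 ≤ F ψ := fun ψ => sq_nonneg _
  have hA0 : (0 : ℝ) < A.card := by exact_mod_cast hA.card_pos
  have hK' : (Fintype.card G : ℝ) ≤ K * A.card := by exact_mod_cast hK
  have hK1 : (1 : ℝ) ≤ K := by
    have h1 : A.card ≤ K * A.card := (Finset.card_le_univ A).trans hK
    have : 1 ≤ K := by
      by_contra h
      have : K = 0 := by omega
      subst this
      have := hA.card_pos
      omega
    exact_mod_cast this
  have hsum : ∑ ψ, F ψ = (Fintype.card G : ℝ) * A.card := AddChar.sum_normSq_sum A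
  have hFz : F 0 = (A.card : ℝ) ^ 2 := by simp [hF]
  -- With this threshold, Parseval bounds the size of `R` by `K ^ 2`, independently of `G`.
  set R : Finset (AddChar G ℂ) := {ψ | (A.card : ℝ) ^ 2 ≤ K * F ψ} with hR
  have h0R : (0 : AddChar G ℂ) ∈ R := by
    simp only [hR, Finset.mem_filter, Finset.mem_univ, true_and, hFz]
    nlinarith [sq_nonneg (A.card : ℝ)]
  refine ⟨R, ⟨0, h0R⟩, ?_, fun n hn => ?_⟩
  · have h1 : (R.card : ℝ) * (A.card : ℝ) ^ 2 ≤ K * ((Fintype.card G : ℝ) * A.card) := by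
      rw [← hsum, Finset.mul_sum, ← nsmul_eq_mul, ← Finset.sum_const]
      refine (Finset.sum_le_sum fun ψ hψ => (Finset.mem_filter.1 hψ).2).trans ?_
      exact Finset.sum_le_sum_of_subset_of_nonneg (Finset.subset_univ _)
        fun ψ _ _ => mul_nonneg (by linarith) (hF0 ψ)
    have h2 : (R.card : ℝ) * (A.card : ℝ) ^ 2 ≤ (K : ℝ) ^ 2 * (A.card : ℝ) ^ 2 := by
      refine h1.trans ?_
      have := mul_le_mul_of_nonneg_left hK' (by positivity : (0 : ℝ) ≤ K * A.card)
      nlinarith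
    have := le_of_mul_le_mul_right h2 (by positivity)
    exact_mod_cast this
  · by_contra! hno
    -- By orthogonality this sum is `card G` times the number of solutions.
    have hzero : ∑ ψ : AddChar G ℂ, ((F ψ : ℝ) : ℂ) * ((F ψ : ℝ) : ℂ) * ψ n = 0 := by
      have : ∀ ψ : AddChar G ℂ, ((F ψ : ℝ) : ℂ) * ((F ψ : ℝ) : ℂ) * ψ n =
          ∑ p ∈ A ×ˢ A, ∑ q ∈ A ×ˢ A, ψ ((p.1 - p.2) + (q.1 - q.2) + n) := by
        intro ψ
        simp only [hF, AddChar.normSq_sum_eq]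
        rw [Finset.sum_mul_sum, Finset.sum_mul]
        refine Finset.sum_congr rfl fun p _ => ?_
        rw [Finset.sum_mul]
        refine Finset.sum_congr rfl fun q _ => ?_
        rw [AddChar.map_add_eq_mul, AddChar.map_add_eq_mul]
      simp_rw [this]
      rw [Finset.sum_comm]
      refine Finset.sum_eq_zero fun p hp => ?_
      rw [Finset.sum_comm]
      refine Finset.sum_eq_zero fun q hq => ?_
      rw [AddChar.sum_apply_eq_ite, if_neg]
      rw [Finset.mem_product] at hp hq
      intro h
      apply hno p.1 hp.1 q.1 hq.1 p.2 hp.2 q.2 hq.2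
      rw [← sub_eq_zero, ← neg_eq_zero, ← h]
      abel
    have hre : ∑ ψ : AddChar G ℂ, F ψ ^ 2 * (ψ n).re = 0 := by
      have := congrArg Complex.re hzero
      rw [Complex.re_sum] at this
      simp_rw [← Complex.ofReal_mul, Complex.re_ofReal_mul, Complex.zero_re, ← sq] at this
      exact this
    rw [← Finset.sum_add_sum_compl R] at hre hsum
    have hbig : (A.card : ℝ) ^ 4 ≤ ∑ ψ ∈ R, F ψ ^ 2 * (ψ n).re := by
      have := Finset.single_le_sum (f := fun ψ : AddChar G ℂ => F ψ ^ 2 * (ψ n).re)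
        (fun ψ hψ => mul_nonneg (sq_nonneg _) (hn ψ hψ).le) h0R
      simp only [hFz, AddChar.zero_apply, Complex.one_re] at this
      nlinarith
    have hbig' : (A.card : ℝ) ^ 2 ≤ ∑ ψ ∈ R, F ψ := by
      rw [← hFz]
      exact Finset.single_le_sum (fun ψ _ => hF0 ψ) h0R
    -- After scaling by `K`, `R` contributes at least `K|A|⁴` (trivial character) and the complement
    -- at least `-|A|²(K|A|² - |A|²)`. The total is at least `|A|⁴ > 0`.
    have hsmall : -((A.card : ℝ) ^ 2 * ∑ ψ ∈ Rᶜ, F ψ) ≤ K * ∑ ψ ∈ Rᶜ, F ψ ^ 2 * (ψ n).re := by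
      rw [Finset.mul_sum, Finset.mul_sum, ← Finset.sum_neg_distrib]
      refine Finset.sum_le_sum fun ψ hψ => ?_
      have h1 : K * F ψ < (A.card : ℝ) ^ 2 := by
        simpa [hR] using hψ
      have h2 : -1 ≤ (ψ n).re := by
        have := (Complex.abs_re_le_norm (ψ n)).trans (AddChar.norm_apply ψ n).le
        exact (abs_le.1 this).1
      have h3 := mul_le_mul_of_nonneg_left h1.le (hF0 ψ)
      have h4 : 0 ≤ (K : ℝ) * F ψ ^ 2 := by positivity
      nlinarith
    have h5 : (A.card : ℝ) ^ 2 * ∑ ψ ∈ Rᶜ, F ψ ≤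
        (A.card : ℝ) ^ 2 * ((K : ℝ) * A.card * A.card - (A.card : ℝ) ^ 2) := by
      gcongr
      have := mul_le_mul_of_nonneg_right hK' hA0.le
      linarith
    have h6 := mul_le_mul_of_nonneg_left hbig (by linarith : (0 : ℝ) ≤ K)
    have h7 : (0 : ℝ) < (A.card : ℝ) ^ 4 := by positivity
    have h8 : (K : ℝ) * (∑ ψ ∈ R, F ψ ^ 2 * (ψ n).re + ∑ ψ ∈ Rᶜ, F ψ ^ 2 * (ψ n).re) = 0 := by
      rw [hre, mul_zero]
    nlinarith

/-- A most popular color on `[0, N)` has density at least `1/(4m)` in `ZMod (4 * N)`, where the sums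
involved do not wrap around. The number of frequencies does not depend on `N`, as the later limit
requires. -/
theorem exists_frequencies_of_coloring {m : ℕ} (c : ℕ → Fin m) (N : ℕ) (hN : 0 < N) :
    ∃ θ : Fin ((4 * m) ^ 2) → UnitAddCircle, ∀ n < N,
      (∀ i, 0 < ((AddCircle.toCircle (n • θ i) : Circle) : ℂ).re) →
        ∃ a b a' b' : ℕ, c b = c a ∧ c a' = c a ∧ c b' = c a ∧ a' + b' = a + b + n := by
  classical
  have hm : 0 < m := Fin.pos (c 0)
  have : NeZero m := ⟨hm.ne'⟩
  have : NeZero (4 * N) := ⟨by omega⟩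
  obtain ⟨col, -, hcol⟩ := Finset.exists_le_card_fiber_of_nsmul_le_card_of_maps_to
    (s := Finset.range N) (t := (Finset.univ : Finset (Fin m))) (f := c)
    (b := (N : ℚ) / m) (fun _ _ => Finset.mem_univ _) Finset.univ_nonempty (by
      have : (m : ℚ) ≠ 0 := by exact_mod_cast hm.ne'
      simp only [Finset.card_univ, Fintype.card_fin, Finset.card_range, nsmul_eq_mul]
      field_simp
      exact le_rfl)
  set S : Finset ℕ := {x ∈ Finset.range N | c x = col} with hS
  have hScard : N ≤ m * S.card := by
    have hm' : (0 : ℚ) < m := by exact_mod_cast hm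
    rw [div_le_iff₀ hm'] at hcol
    have : N ≤ S.card * m := by exact_mod_cast hcol
    linarith
  have hSN : ∀ x ∈ S, x < N ∧ c x = col := by simp [hS]
  set A : Finset (ZMod (4 * N)) := S.image (fun x : ℕ => (x : ZMod (4 * N))) with hA
  have hAcard : A.card = S.card := by
    refine Finset.card_image_of_injOn fun x hx y hy hxy => ?_
    have hx' := (hSN x hx).1
    have hy' := (hSN y hy).1
    simp only [ZMod.natCast_eq_natCast_iff'] at hxy
    rwa [Nat.mod_eq_of_lt (by omega), Nat.mod_eq_of_lt (by omega)] at hxy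
  have hAne : A.Nonempty := by
    rw [← Finset.card_pos, hAcard]
    rcases Nat.eq_zero_or_pos S.card with h | h
    · rw [h] at hScard; omega
    · exact h
  obtain ⟨R, ⟨ψ₀, -⟩, hRcard, hR⟩ :=
    exists_add_eq_add_add_of_large_spectrum A hAne (4 * m) (by
      rw [ZMod.card, hAcard, mul_assoc]; omega)
  have hsurj : ∀ z : Circle, ∃ x : UnitAddCircle, AddCircle.toCircle x = z := fun z =>
    ⟨(AddCircle.homeomorphCircle one_ne_zero).symm z, by
      rw [← AddCircle.homeomorphCircle_apply one_ne_zero, Homeomorph.apply_symm_apply]⟩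
  choose x hx using fun ψ : AddChar (ZMod (4 * N)) ℂ =>
    hsurj ⟨ψ 1, mem_sphere_zero_iff_norm.2 (AddChar.norm_apply ψ 1)⟩
  -- Padding with `ψ₀` makes the number of frequencies exactly `(4 * m) ^ 2`; extra entries only
  -- strengthen the condition on `n`.
  refine ⟨fun i => if h : (i : ℕ) < R.card then x (R.equivFin.symm ⟨i, h⟩) else x ψ₀,
    fun n hn hpos => ?_⟩
  obtain ⟨a, ha, b, hb, a', ha', b', hb', h⟩ := hR n fun ψ hψ => by
    have hlt : (R.equivFin ⟨ψ, hψ⟩ : ℕ) < R.card := (R.equivFin ⟨ψ, hψ⟩).2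
    have := hpos ⟨R.equivFin ⟨ψ, hψ⟩, hlt.trans_le hRcard⟩
    simp only [hlt, dite_true, Fin.eta, Equiv.symm_apply_apply, AddCircle.toCircle_nsmul,
      hx] at this
    rwa [← nsmul_one, AddChar.map_nsmul_eq_pow]
  simp only [hA, Finset.mem_image] at ha hb ha' hb'
  obtain ⟨a, ha, rfl⟩ := ha
  obtain ⟨b, hb, rfl⟩ := hb
  obtain ⟨a', ha', rfl⟩ := ha'
  obtain ⟨b', hb', rfl⟩ := hb'
  obtain ⟨ha, hca⟩ := hSN a ha
  obtain ⟨hb, hcb⟩ := hSN b hb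
  obtain ⟨ha', hca'⟩ := hSN a' ha'
  obtain ⟨hb', hcb'⟩ := hSN b' hb'
  refine ⟨a, b, a', b', by rw [hcb, hca], by rw [hca', hca], by rw [hcb', hca], ?_⟩
  norm_cast at h
  rw [ZMod.natCast_eq_natCast_iff'] at h
  rwa [Nat.mod_eq_of_lt (by omega), Nat.mod_eq_of_lt (by omega)] at h

/-- **Bogoliubov's theorem** for finite colorings of `ℕ`. -/
theorem isBohrZero_of_coloring {m : ℕ} (c : ℕ → Fin m) :
    IsBohrZero {n : ℕ+ | ∃ a b a' b' : ℕ, c b = c a ∧ c a' = c a ∧ c b' = c a ∧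
      a' + b' = a + b + n} := by
  choose θ hθ using fun N : ℕ => exists_frequencies_of_coloring c (N + 1) N.succ_pos
  -- All `θ N` lie in one compact torus. Positivity of the real part is an open condition, so it
  -- passes from `n • α` to `n • θ (φ N)` for large `N`.
  obtain ⟨α, -, φ, hφ, hlim⟩ := isCompact_univ.tendsto_subseq (x := θ) fun _ => Set.mem_univ _
  have hcont : Continuous fun x : UnitAddCircle => ((AddCircle.toCircle x : Circle) : ℂ).re :=
    Complex.continuous_re.comp (continuous_subtype_val.comp AddCircle.continuous_toCircle)
  obtain ⟨δ, hδ, hball⟩ := Metric.isOpen_iff.1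
    ((isOpen_Ioi (a := (0 : ℝ))).preimage hcont) 0 (by simp)
  refine ⟨_, α, δ, hδ, fun n hn => ?_⟩
  have hn' := (pi_norm_lt_iff hδ).1 hn
  have hev : ∀ᶠ N in Filter.atTop, ∀ i,
      0 < ((AddCircle.toCircle ((n : ℕ) • θ (φ N) i) : Circle) : ℂ).re := by
    rw [Filter.eventually_all]
    intro i
    have h1 : Filter.Tendsto (fun N => ((AddCircle.toCircle ((n : ℕ) • θ (φ N) i) : Circle) : ℂ).re)
        Filter.atTop (nhds ((AddCircle.toCircle ((n : ℕ) • α i) : Circle) : ℂ).re) :=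
      ((hcont.comp (continuous_nsmul (n : ℕ))).tendsto (α i)).comp
        ((tendsto_pi_nhds.1 hlim) i)
    refine h1.eventually_const_lt ?_
    apply hball
    rw [mem_ball_zero_iff]
    exact hn' i
  obtain ⟨N, hN, hNn⟩ := (hev.and (Filter.eventually_ge_atTop (n : ℕ))).exists
  exact hθ (φ N) n (by have := hφ.id_le N; simp only [id] at this; omega) hN

/-! ### Almost periods in equicontinuous systems -/

section

open Filter Topology

/-- Some point of an equicontinuous system is recurrent, with arbitrarily large return times. -/
theorem exists_recurrent_point {X : Type*} [MetricSpace X] [CompactSpace X] [Nonempty X]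
    (T : X → X) (hTeq : UniformEquicontinuous (fun n : ℕ => T^[n])) :
    ∃ y : X, ∀ δ > 0, ∀ N : ℕ, ∃ s ≥ N, dist (T^[s] y) y < δ := by
  obtain ⟨x⟩ := ‹Nonempty X›
  obtain ⟨y, -, φ, hφ, hlim⟩ := isCompact_univ.tendsto_subseq (x := fun n => T^[n] x)
    fun _ => Set.mem_univ _
  refine ⟨y, fun δ hδ N => ?_⟩
  obtain ⟨γ, hγ, hγT⟩ := Metric.uniformEquicontinuous_iff.1 hTeq (δ / 2) (by positivity)
  have h1 := Metric.tendsto_atTop.1 hlim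
  obtain ⟨i, hi⟩ := h1 γ hγ
  obtain ⟨j, hj⟩ := h1 (δ / 2) (by positivity)
  set k := max j (φ i + N)
  have hk : φ i + N ≤ φ k := (le_max_right _ _).trans (hφ.id_le k)
  -- Equicontinuity pushes the approximation of `y` by `T^[φ i] x` forward to time `φ k`, when the
  -- orbit of `x` is again near `y`.
  refine ⟨φ k - φ i, by omega, ?_⟩
  have h2 := hγT _ _ (hi i le_rfl) (φ k - φ i)
  simp only [Function.comp_apply] at h2
  rw [← Function.iterate_add_apply, Nat.sub_add_cancel (by omega), dist_comm] at h2
  have h3 := hj k (le_max_left _ _)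
  simp only [Function.comp_apply] at h3
  linarith [dist_triangle (T^[φ k - φ i] y) (T^[φ k] x) y]

/-- An equicontinuous system has a point whose orbit is uniformly almost periodic along
Bohr₀ sets. -/
theorem exists_isBohrZero_dist_lt {X : Type*} [MetricSpace X] [CompactSpace X] [Nonempty X]
    (T : X → X) (hTeq : UniformEquicontinuous (fun n : ℕ => T^[n])) :
    ∃ y : X, ∀ δ > 0,
      IsBohrZero {n : ℕ+ | ∀ j : ℕ, dist (T^[j + n] y) (T^[j] y) < δ} := by
  obtain ⟨y, hy⟩ := exists_recurrent_point T hTeq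
  refine ⟨y, fun δ hδ => ?_⟩
  have key : ∀ r > 0, ∃ s > 0, s ≤ r ∧ ∀ u v : X, dist u v < s →
      ∀ n, dist (T^[n] u) (T^[n] v) < r := by
    intro r hr
    obtain ⟨s, hs, h⟩ := Metric.uniformEquicontinuous_iff.1 hTeq r hr
    exact ⟨min s r, lt_min hs hr, min_le_right _ _,
      fun u v huv n => h u v (huv.trans_le (min_le_left _ _)) n⟩
  obtain ⟨δ₁, hδ₁, -, h₁⟩ := key δ hδ
  obtain ⟨δ₂, hδ₂, h₂₁, h₂⟩ := key (δ₁ / 3) (by positivity)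
  obtain ⟨δ₃, hδ₃, -, h₃⟩ := key (δ₂ / 4) (by positivity)
  obtain ⟨t, -, htf, ht⟩ := finite_cover_balls_of_compact (isCompact_univ (X := X)) (half_pos hδ₃)
  have : ∀ j : ℕ, ∃ p : t, T^[j] y ∈ Metric.ball (p : X) (δ₃ / 2) := by
    intro j
    have := ht (Set.mem_univ (T^[j] y))
    simp only [Set.mem_iUnion] at this
    obtain ⟨p, hp, h⟩ := this
    exact ⟨⟨p, hp⟩, h⟩
  choose p hp using this
  have := htf.fintype
  set c : ℕ → Fin (Fintype.card t) := fun j => Fintype.equivFin t (p j)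
  have hc : ∀ a b, c a = c b → dist (T^[a] y) (T^[b] y) < δ₃ := by
    intro a b hab
    have hpab : p a = p b := (Fintype.equivFin t).injective hab
    have h1 := hp a
    have h2 := hp b
    rw [hpab] at h1
    rw [Metric.mem_ball] at h1 h2
    linarith [dist_triangle_right (T^[a] y) (T^[b] y) (p b)]
  refine (isBohrZero_of_coloring c).mono ?_
  rintro n ⟨a, b, a', b', hb, ha', hb', h⟩ j
  rw [Function.iterate_add_apply]
  apply h₁
  -- Since `n + (a + b) = a' + b'`, replace `a'` by `a` and then `b'` by `b`; all four times have
  -- the same color.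
  have e1 : dist (T^[n + (a + b)] y) (T^[a + b] y) < δ₂ := by
    have h5 : (n : ℕ) + (a + b) = b' + a' := by omega
    rw [h5]
    have g1 := h₃ _ _ (hc a' a ha') b'
    have g2 := h₃ _ _ (hc b' b (by rw [hb', hb])) a
    rw [← Function.iterate_add_apply, ← Function.iterate_add_apply] at g1 g2
    rw [add_comm b' a] at g1
    linarith [dist_triangle (T^[b' + a'] y) (T^[a + b'] y) (T^[a + b] y)]
  -- `T` need not be invertible, so recurrence of `y` removes the offset `a + b`: move forward to a
  -- time `s` at which the orbit is back near `y`.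
  obtain ⟨s, hs, hsy⟩ := hy δ₂ hδ₂ (a + b)
  have g1 := h₂ _ _ hsy n
  have g2 := h₂ _ _ e1 (s - (a + b))
  rw [← Function.iterate_add_apply, ← Function.iterate_add_apply, Nat.sub_add_cancel hs] at g2
  rw [← Function.iterate_add_apply] at g1
  have h6 : s - (a + b) + (n + (a + b)) = n + s := by omega
  rw [h6] at g2
  rw [dist_comm] at g1
  have := dist_triangle4 (T^[n] y) (T^[n + s] y) (T^[s] y) y
  linarith

/-! ### Real lifts and means of sequences -/

theorem UnitAddCircle.coe_intCast (k : ℤ) : ((k : ℝ) : UnitAddCircle) = 0 :=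
  (AddCircle.coe_eq_zero_iff 1).2 ⟨k, by simp⟩

theorem UnitAddCircle.exists_coe_eq_abs_eq_norm (x : UnitAddCircle) :
    ∃ r : ℝ, (r : UnitAddCircle) = x ∧ |r| = ‖x‖ := by
  obtain ⟨s, rfl⟩ := QuotientAddGroup.mk_surjective x
  refine ⟨s - round s, ?_, (UnitAddCircle.norm_eq).symm⟩
  rw [AddCircle.coe_sub, UnitAddCircle.coe_intCast, sub_zero]

theorem UnitAddCircle.norm_coe_le_abs (r : ℝ) : ‖(r : UnitAddCircle)‖ ≤ |r| := by
  rw [UnitAddCircle.norm_eq]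
  simpa using round_le r 0

/-- A discrete intermediate value theorem for sequences with small steps. -/
theorem exists_abs_sub_lt_or_of_small_steps {ψ : ℕ → ℝ} {η : ℝ}
    (hψ : ∀ j, |ψ (j + 1) - ψ j| < η) (s : ℝ) :
    (∃ j, |ψ j - s| < η) ∨ (∀ j, ψ j ≤ s - η) ∨ ∀ j, s + η ≤ ψ j := by
  by_cases h : ∃ j, |ψ j - s| < η
  · exact Or.inl h
  right
  push Not at h
  rcases le_abs.1 (h 0) with h0 | h0
  · right
    intro j
    induction j with
    | zero => linarith
    | succ j ih =>
      rcases le_abs.1 (h (j + 1)) with h1 | h1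
      · linarith
      · have := (abs_lt.1 (hψ j)).1
        have := abs_nonneg (ψ (j + 1) - ψ j)
        linarith [hψ j]
  · left
    intro j
    induction j with
    | zero => linarith
    | succ j ih =>
      rcases le_abs.1 (h (j + 1)) with h1 | h1
      · have := (abs_lt.1 (hψ j)).2
        have := abs_nonneg (ψ (j + 1) - ψ j)
        linarith [hψ j]
      · linarith

/-- A bounded sequence `x` has a generalized mean `μ` that is nearly attained by the sums over
windows of length `k`, as soon as `x` is almost `k`-periodic. -/
theorem exists_mean_of_bounded {x : ℕ → ℝ} {C : ℝ} (hx : ∀ l, |x l| ≤ C) :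
    ∃ μ : ℝ, ∀ (k : ℕ) (η : ℝ), 0 < η → (∀ l, |x (l + k) - x l| < η) →
      ∃ l, |∑ i ∈ Finset.range k, x (l + i) - k * μ| < η := by
  have hC : 0 ≤ C := (abs_nonneg _).trans (hx 0)
  have havg : ∀ L : ℕ, (∑ l ∈ Finset.range L, x l) / L ∈ Set.Icc (-C) C := by
    intro L
    rw [Set.mem_Icc, ← abs_le, abs_div, Nat.abs_cast]
    refine div_le_of_le_mul₀ (Nat.cast_nonneg _) hC ?_
    calc _ ≤ ∑ l ∈ Finset.range L, |x l| := Finset.abs_sum_le_sum_abs _ _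
      _ ≤ ∑ l ∈ Finset.range L, C := Finset.sum_le_sum fun l _ => hx l
      _ = C * L := by simp [mul_comm]
  -- The subsequence is fixed before `k`, so one `μ` serves all window lengths.
  obtain ⟨μ, -, φ, hφ, hlim⟩ := isCompact_Icc.tendsto_subseq havg
  have hinv : Tendsto (fun n => ((φ n : ℕ) : ℝ)⁻¹) atTop (𝓝 0) :=
    tendsto_inv_atTop_zero.comp (tendsto_natCast_atTop_atTop.comp hφ.tendsto_atTop)
  have hshift : ∀ i : ℕ,
      Tendsto (fun n => (∑ l ∈ Finset.range (φ n), x (l + i)) / φ n) atTop (𝓝 μ) := by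
    intro i
    induction i with
    | zero => exact hlim
    | succ i ih =>
      have h0 : Tendsto (fun n => (x (φ n + i) - x i) * ((φ n : ℕ) : ℝ)⁻¹) atTop (𝓝 0) := by
        refine squeeze_zero_norm (a := fun n => (C + C) * ((φ n : ℕ) : ℝ)⁻¹) (fun n => ?_)
          (by simpa using hinv.const_mul (C + C))
        rw [norm_mul, Real.norm_eq_abs, Real.norm_eq_abs, abs_inv, Nat.abs_cast]
        gcongr
        exact (abs_sub _ _).trans (add_le_add (hx _) (hx _))
      have := ih.add h0
      rw [add_zero] at this
      refine this.congr fun n => ?_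
      rw [div_eq_mul_inv, div_eq_mul_inv, ← add_mul]
      congr 1
      have h1 := Finset.sum_range_succ (fun l => x (l + i)) (φ n)
      rw [Finset.sum_range_succ'] at h1
      simp only [zero_add] at h1
      have h2 : ∀ l, x (l + 1 + i) = x (l + (i + 1)) := fun l => by congr 1; omega
      simp only [h2] at h1
      linarith
  refine ⟨μ, fun k η hη hk => ?_⟩
  set Φ : ℕ → ℝ := fun l => ∑ i ∈ Finset.range k, x (l + i) with hΦ
  have hΦlim : Tendsto (fun n => (∑ l ∈ Finset.range (φ n), Φ l) / φ n) atTop (𝓝 (k * μ)) := by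
    have := tendsto_finsetSum (Finset.range k) fun i _ => hshift i
    simp only [Finset.sum_const, Finset.card_range, nsmul_eq_mul] at this
    refine this.congr fun n => ?_
    rw [← Finset.sum_div, Finset.sum_comm]
  have hstep : ∀ l, |Φ (l + 1) - Φ l| < η := by
    intro l
    have h1 := Finset.sum_range_succ (fun i => x (l + i)) k
    rw [Finset.sum_range_succ'] at h1
    have h2 : ∀ i, x (l + (i + 1)) = x (l + 1 + i) := fun i => by congr 1; omega
    simp only [h2, add_zero] at h1
    have h3 : Φ (l + 1) - Φ l = x (l + k) - x l := by
      simp only [hΦ]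
      linarith
    rw [h3]
    exact hk l
  have hpos : ∀ᶠ n in atTop, 0 < ((φ n : ℕ) : ℝ) := by
    filter_upwards [eventually_ge_atTop 1] with n hn
    have := hφ.id_le n
    simp only [id] at this
    exact_mod_cast (by omega : 0 < φ n)
  -- `Φ` has small steps and mean `k * μ` along `φ`, so it cannot stay on one side of `k * μ` at
  -- distance `η`.
  rcases exists_abs_sub_lt_or_of_small_steps hstep (k * μ) with h | h | h
  · exact h
  · exfalso
    have : (k : ℝ) * μ ≤ k * μ - η := by
      refine le_of_tendsto hΦlim ?_
      filter_upwards [hpos] with n hn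
      rw [div_le_iff₀ hn]
      calc _ ≤ ∑ l ∈ Finset.range (φ n), (k * μ - η) := Finset.sum_le_sum fun l _ => h l
        _ = _ := by rw [Finset.sum_const, Finset.card_range, nsmul_eq_mul, mul_comm]
    linarith
  · exfalso
    have : (k : ℝ) * μ + η ≤ k * μ := by
      refine ge_of_tendsto hΦlim ?_
      filter_upwards [hpos] with n hn
      rw [le_div_iff₀ hn]
      calc _ = ∑ l ∈ Finset.range (φ n), (k * μ + η) := by
            rw [Finset.sum_const, Finset.card_range, nsmul_eq_mul, mul_comm]
        _ ≤ _ := Finset.sum_le_sum fun l _ => h l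
    linarith

/-- A bounded real sequence with small steps that is almost `n`-periodic modulo `1` is almost
`n`-periodic. -/
theorem abs_shift_sub_lt_of_norm_coe_lt {ψ : ℕ → ℝ} {C : ℝ} (hψ : ∀ j, |ψ j| ≤ C)
    (hstep : ∀ j, |ψ (j + 1) - ψ j| < 1 / 4) {n : ℕ} {η : ℝ} (hη : η ≤ 1 / 4)
    (h : ∀ j, ‖((ψ (j + n) - ψ j : ℝ) : UnitAddCircle)‖ < η) (j : ℕ) :
    |ψ (j + n) - ψ j| < η := by
  simp only [UnitAddCircle.norm_eq] at h
  -- The nearest integer cannot jump under small steps. A nonzero constant value would make `ψ`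
  -- drift linearly along multiples of `n`, against boundedness.
  set r : ℕ → ℤ := fun j => round (ψ (j + n) - ψ j) with hr
  have hconst : ∀ j, r j = r 0 := by
    intro j
    induction j with
    | zero => rfl
    | succ j ih =>
      rw [← ih]
      have h1 := abs_lt.1 (h j)
      have h2 := abs_lt.1 (h (j + 1))
      have h3 := abs_lt.1 (hstep j)
      have h4 := abs_lt.1 (hstep (j + n))
      rw [show j + n + 1 = j + 1 + n by omega] at h4
      change _ < ψ (j + n) - ψ j - (r j : ℝ) ∧ ψ (j + n) - ψ j - (r j : ℝ) < _ at h1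
      change _ < ψ (j + 1 + n) - ψ (j + 1) - (r (j + 1) : ℝ) ∧
        ψ (j + 1 + n) - ψ (j + 1) - (r (j + 1) : ℝ) < _ at h2
      have h5 : (-1 : ℝ) < r (j + 1) - r j := by linarith
      have h6 : (r (j + 1) - r j : ℝ) < 1 := by linarith
      have h5' : (-1 : ℤ) < r (j + 1) - r j := by exact_mod_cast h5
      have h6' : r (j + 1) - r j < 1 := by exact_mod_cast h6
      omega
  have htel : ∀ k : ℕ, |ψ (k * n) - ψ 0 - k * r 0| ≤ k * (1 / 4) := by
    intro k
    induction k with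
    | zero => simp
    | succ k ih =>
      have h1 := abs_lt.1 (h (k * n))
      change _ < ψ (k * n + n) - ψ (k * n) - (r (k * n) : ℝ) ∧
        ψ (k * n + n) - ψ (k * n) - (r (k * n) : ℝ) < _ at h1
      rw [hconst] at h1
      rw [abs_le] at ih ⊢
      rw [Nat.succ_mul]
      push_cast
      constructor <;> linarith
  have hr0 : r 0 = 0 := by
    by_contra hne
    have h1 : (1 : ℝ) ≤ |(r 0 : ℝ)| := by exact_mod_cast Int.one_le_abs hne
    obtain ⟨k, hk⟩ := exists_nat_gt (4 * C)
    have h2 := htel k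
    have h3 : |(k : ℝ) * r 0| ≤ |ψ (k * n) - ψ 0 - k * r 0| + (|ψ (k * n)| + |ψ 0|) := by
      have := abs_sub_abs_le_abs_sub ((k : ℝ) * r 0) (ψ (k * n) - ψ 0)
      rw [abs_sub_comm ((k : ℝ) * r 0)] at this
      linarith [abs_sub (ψ (k * n)) (ψ 0)]
    rw [abs_mul, Nat.abs_cast] at h3
    have h4 := mul_le_mul_of_nonneg_left h1 (Nat.cast_nonneg k : (0 : ℝ) ≤ k)
    have h5 := (abs_nonneg _).trans (hψ 0)
    linarith [hψ 0, hψ (k * n)]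
  have h1 := h j
  change |ψ (j + n) - ψ j - (r j : ℝ)| < η at h1
  rwa [hconst, hr0, Int.cast_zero, sub_zero] at h1

/-! ### Window sums of almost periodic sequences -/

theorem sum_range_succ_shift {M : Type*} [AddCommGroup M] (a : ℕ → M) (n j : ℕ) :
    ∑ i ∈ Finset.range n, a (j + 1 + i) =
      ∑ i ∈ Finset.range n, a (j + i) + (a (j + n) - a j) := by
  have h1 := Finset.sum_range_succ (fun i => a (j + i)) n
  rw [Finset.sum_range_succ'] at h1
  have h2 : ∀ i, a (j + (i + 1)) = a (j + 1 + i) := fun i => by congr 1; omega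
  simp only [h2, add_zero] at h1
  rw [← add_sub_assoc, ← h1, add_sub_cancel_right]

theorem sum_range_mul_shift {M : Type*} [AddCommMonoid M] (a : ℕ → M) (k q l : ℕ) :
    ∑ i ∈ Finset.range (k * q), a (l * q + i) =
      ∑ i ∈ Finset.range k, ∑ i' ∈ Finset.range q, a ((l + i) * q + i') := by
  induction k with
  | zero => simp
  | succ k ih =>
    rw [Nat.succ_mul, Finset.sum_range_add, ih, Finset.sum_range_succ]
    congr 1
    refine Finset.sum_congr rfl fun i _ => ?_
    congr 1
    ring

/-- A sequence in `𝕋` with small steps lifts to a real sequence with small steps. -/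
theorem exists_lift_of_small_steps {S : ℕ → UnitAddCircle} {η : ℝ}
    (hS : ∀ j, ‖S (j + 1) - S j‖ < η) :
    ∃ ψ : ℕ → ℝ, ψ 0 = 0 ∧ (∀ j, |ψ (j + 1) - ψ j| < η) ∧
      ∀ j, S j = S 0 + (ψ j : UnitAddCircle) := by
  choose g hg hg' using fun j => UnitAddCircle.exists_coe_eq_abs_eq_norm (S (j + 1) - S j)
  refine ⟨fun j => ∑ i ∈ Finset.range j, g i, by simp, fun j => ?_, fun j => ?_⟩
  · simpa only [Finset.sum_range_succ, add_sub_cancel_left, hg'] using hS j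
  · induction j with
    | zero => simp
    | succ j ih =>
      simp only at ih ⊢
      rw [Finset.sum_range_succ, AddCircle.coe_add, ← add_assoc, ← ih, hg, add_sub_cancel]

/-- An unbounded lift with small steps comes close to every point of the circle. -/
theorem exists_norm_lt_of_unbounded {S : ℕ → UnitAddCircle} {ψ : ℕ → ℝ} {η : ℝ}
    (hψ0 : ψ 0 = 0) (hstep : ∀ j, |ψ (j + 1) - ψ j| < η)
    (hS : ∀ j, S j = S 0 + (ψ j : UnitAddCircle)) (hub : ¬ ∃ C, ∀ j, |ψ j| ≤ C) :
    ∃ j, ‖S j‖ < η := by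
  have hη : 0 < η := (abs_nonneg _).trans_lt (hstep 0)
  obtain ⟨s, hs, hs'⟩ := UnitAddCircle.exists_coe_eq_abs_eq_norm (S 0)
  have hs1 : |s| ≤ 1 := by
    rw [hs']
    have := UnitAddCircle.norm_coe_le_abs (Int.fract s)
    have h2 : ((Int.fract s : ℝ) : UnitAddCircle) = S 0 := by
      rw [Int.fract, AddCircle.coe_sub, UnitAddCircle.coe_intCast, sub_zero, hs]
    rw [h2, abs_of_nonneg (Int.fract_nonneg s)] at this
    exact this.trans (Int.fract_lt_one s).le
  have key : ∀ k : ℤ, (∃ j, |ψ j - (k - s)| < η) → ∃ j, ‖S j‖ < η := by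
    rintro k ⟨j, hj⟩
    refine ⟨j, lt_of_le_of_lt ?_ hj⟩
    have : S j = ((ψ j - (k - s) : ℝ) : UnitAddCircle) := by
      rw [hS j, AddCircle.coe_sub, AddCircle.coe_sub, UnitAddCircle.coe_intCast, hs]
      abel
    rw [this]
    exact UnitAddCircle.norm_coe_le_abs _
  rw [abs_le] at hs1
  -- If `ψ` avoids the `η`-neighborhoods of `-1 - s` and `1 - s`, it stays trapped between them,
  -- since `ψ 0 = 0`.
  by_contra hno
  apply hub
  refine ⟨2, fun j => ?_⟩
  rw [abs_le]
  constructor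
  · rcases exists_abs_sub_lt_or_of_small_steps hstep ((-1 : ℤ) - s) with h | h | h
    · exact absurd (key _ h) hno
    · have := h 0
      push_cast at this
      linarith
    · have := h j
      push_cast at this
      linarith
  · rcases exists_abs_sub_lt_or_of_small_steps hstep ((1 : ℤ) - s) with h | h | h
    · exact absurd (key _ h) hno
    · have := h j
      push_cast at this
      linarith
    · have := h 0
      push_cast at this
      linarith

/-- Window sums of a sequence in `𝕋` that is almost periodic along Bohr₀ sets come close to `0`
along a Bohr₀ set of window lengths. -/
theorem isBohrZero_exists_norm_sum_lt {a : ℕ → UnitAddCircle}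
    (ha : ∀ η > 0, IsBohrZero {n : ℕ+ | ∀ j : ℕ, ‖a (j + n) - a j‖ < η}) {ε : ℝ} (hε : 0 < ε) :
    IsBohrZero {n : ℕ+ | ∃ j : ℕ, ‖∑ i ∈ Finset.range n, a (j + i)‖ < ε} := by
  set S : ℕ → ℕ → UnitAddCircle := fun n j => ∑ i ∈ Finset.range n, a (j + i) with hSdef
  have hSstep : ∀ n j, S n (j + 1) - S n j = a (j + n) - a j := by
    intro n j
    simp only [hSdef]
    rw [sum_range_succ_shift, add_sub_cancel_left]
  set η : ℝ := min ε (1 / 4) with hη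
  have hη0 : 0 < η := lt_min hε (by norm_num)
  have hB := ha η hη0
  set B := {n : ℕ+ | ∀ j : ℕ, ‖a (j + n) - a j‖ < η}
  have hlift := fun (n : ℕ+) (hn : n ∈ B) =>
    exists_lift_of_small_steps (S := S n) (η := η) fun j => by
      rw [hSstep]
      exact hn j
  choose! ψ hψ0 hψstep hψ using hlift
  by_cases hub : ∀ n ∈ B, ¬ ∃ C, ∀ j, |ψ n j| ≤ C
  · refine hB.mono fun n hn => ?_
    obtain ⟨j, hj⟩ := exists_norm_lt_of_unbounded (hψ0 n hn) (hψstep n hn) (hψ n hn) (hub n hn)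
    exact ⟨j, hj.trans_le (min_le_left _ _)⟩
  push Not at hub
  obtain ⟨q, hq, C, hC⟩ := hub
  set η₂ : ℝ := min (ε / 2) (1 / 4)
  have hη₂ : 0 < η₂ := lt_min (half_pos hε) (by norm_num)
  obtain ⟨μ, hμ⟩ := exists_mean_of_bounded (x := fun l => ψ q (l * q)) (C := C) fun l => hC _
  have hq0 : (q : ℝ) ≠ 0 := by exact_mod_cast q.ne_zero
  obtain ⟨v, hv, -⟩ := UnitAddCircle.exists_coe_eq_abs_eq_norm (S q 0)
  set β : UnitAddCircle := (((v + μ) / q : ℝ) : UnitAddCircle) with hβ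
  -- `q • β` is the mean block sum, so a window of `k` blocks should sum to about `(k * q) • β`.
  have hqβ : (q : ℕ) • β = S q 0 + (μ : UnitAddCircle) := by
    rw [hβ, ← AddCircle.coe_nsmul, nsmul_eq_mul, mul_div_cancel₀ _ hq0, AddCircle.coe_add, hv]
  refine ((ha (η₂ / q) (div_pos hη₂ (by exact_mod_cast q.pos))).inter
    ((isBohrZero_multiples q q.pos).inter
      (isBohrZero_norm_nsmul_lt β (half_pos hε)))).mono ?_
  rintro n ⟨hn, ⟨k, hk⟩, hnβ⟩
  -- The shift is small modulo `1`; boundedness of the lift upgrades this to the reals, as `hμ`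
  -- requires.
  have hper : ∀ j, |ψ q (j + n) - ψ q j| < η₂ := by
    refine abs_shift_sub_lt_of_norm_coe_lt hC
      (fun j => (hψstep q hq j).trans_le (min_le_right _ _)) (min_le_right _ _) fun j => ?_
    have h1 : ((ψ q (j + n) - ψ q j : ℝ) : UnitAddCircle) = S q (j + n) - S q j := by
      rw [hψ q hq (j + n), hψ q hq j, AddCircle.coe_sub]
      abel
    rw [h1]
    simp only [hSdef]
    rw [← Finset.sum_sub_distrib]
    refine (norm_sum_le _ _).trans_lt ?_
    calc _ < ∑ i ∈ Finset.range q, η₂ / q := by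
          refine Finset.sum_lt_sum_of_nonempty (by simp) fun i _ => ?_
          have := hn (j + i)
          rwa [show j + i + (n : ℕ) = j + n + i by omega] at this
      _ = η₂ := by
          rw [Finset.sum_const, Finset.card_range, nsmul_eq_mul]
          field_simp
  obtain ⟨l, hl⟩ := hμ k η₂ hη₂ fun l => by
    have := hper (l * q)
    rwa [hk, mul_comm (q : ℕ) k, ← add_mul] at this
  refine ⟨l * q, ?_⟩
  have hsum : ∑ i ∈ Finset.range (n : ℕ), a (l * q + i) =
      (n : ℕ) • β + ((∑ i ∈ Finset.range k, ψ q ((l + i) * q) - k * μ : ℝ) : UnitAddCircle) := by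
    rw [hk, mul_comm (q : ℕ) k, sum_range_mul_shift, mul_smul, hqβ]
    have h1 : ∀ i, ∑ i' ∈ Finset.range (q : ℕ), a ((l + i) * q + i') =
        S q 0 + (ψ q ((l + i) * q) : UnitAddCircle) := fun i => hψ q hq _
    simp only [h1]
    rw [Finset.sum_add_distrib, Finset.sum_const, Finset.card_range, AddCircle.coe_sub,
      smul_add, ← nsmul_eq_mul, AddCircle.coe_nsmul]
    have h2 : ((∑ i ∈ Finset.range k, ψ q ((l + i) * q) : ℝ) : UnitAddCircle) =
        ∑ i ∈ Finset.range k, (ψ q ((l + i) * q) : UnitAddCircle) :=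
      map_sum (QuotientAddGroup.mk' (AddSubgroup.zmultiples (1 : ℝ))) _ _
    rw [h2]
    abel
  rw [hsum]
  have h3 := UnitAddCircle.norm_coe_le_abs
    (∑ i ∈ Finset.range k, ψ q ((l + i) * q) - k * μ)
  have h4 : η₂ ≤ ε / 2 := min_le_left _ _
  have h5 : ‖(n : ℕ) • β‖ < ε / 2 := hnβ
  refine (norm_add_le _ _).trans_lt ?_
  linarith

end

/-! ### Sums of translates of a circle map -/

/-- A continuous self-map of the circle lifts to a real function. -/
theorem exists_real_lift {h : UnitAddCircle → UnitAddCircle} (hh : Continuous h) :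
    ∃ (H : ℝ → ℝ) (k : ℤ), Continuous H ∧ (∀ x : ℝ, (H x : UnitAddCircle) = h x) ∧
      ∀ x, H (x + 1) = H x + k := by
  have hcov : IsCoveringMap ((↑) : ℝ → AddCircle (1 : ℝ)) := AddCircle.isCoveringMap_coe 1
  obtain ⟨e, he⟩ := QuotientAddGroup.mk_surjective (h ((0 : ℝ) : UnitAddCircle))
  obtain ⟨H, ⟨-, hH⟩, -⟩ := hcov.existsUnique_continuousMap_lifts
    (⟨fun x : ℝ => h (x : UnitAddCircle), hh.comp (AddCircle.continuous_mk' 1)⟩ :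
      C(ℝ, AddCircle (1 : ℝ))) 0 e he
  have hH' : ∀ x : ℝ, (H x : UnitAddCircle) = h x := fun x => congrFun hH x
  have hper : ∀ x : ℝ, ((x + 1 : ℝ) : UnitAddCircle) = x := fun x => AddCircle.coe_add_period 1 x
  obtain ⟨k, hk⟩ : ∃ k : ℤ, (k : ℝ) = H 1 - H 0 := by
    have : ((H 1 - H 0 : ℝ) : UnitAddCircle) = 0 := by
      rw [AddCircle.coe_sub, hH', hH', ← hper 0, zero_add, sub_self]
    obtain ⟨k, hk⟩ := (AddCircle.coe_eq_zero_iff 1).1 this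
    exact ⟨k, by simpa using hk⟩
  refine ⟨H, k, H.continuous, hH', fun x => ?_⟩
  have := hcov.eq_of_comp_eq (g₁ := fun x => H (x + 1)) (g₂ := fun x => H x + k)
    (by fun_prop) (by fun_prop) (funext fun x => ?_) 0 (by simp [hk])
  · exact congrFun this x
  · change ((H (x + 1) : ℝ) : UnitAddCircle) = ((H x + k : ℝ) : UnitAddCircle)
    rw [AddCircle.coe_add, UnitAddCircle.coe_intCast, add_zero, hH', hH', hper]

/-- Sums of translates of a continuous self-map `h` of the circle attain a multiple of a
constant that depends only on `h`. -/
theorem exists_forall_exists_sum_add_eq {h : UnitAddCircle → UnitAddCircle} (hh : Continuous h) :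
    ∃ c : UnitAddCircle, ∀ (n : ℕ), 0 < n → ∀ s : ℕ → UnitAddCircle,
      ∃ t, ∑ i ∈ Finset.range n, h (s i + t) = n • c := by
  obtain ⟨H, k, hH, hHh, hk⟩ := exists_real_lift hh
  have hlift : ∀ (n : ℕ) (s : ℕ → UnitAddCircle), ∃ σ : ℕ → ℝ, ∀ x : ℝ,
      ((∑ i ∈ Finset.range n, H (σ i + x) : ℝ) : UnitAddCircle) =
        ∑ i ∈ Finset.range n, h (s i + x) := by
    intro n s
    choose σ hσ using fun i => QuotientAddGroup.mk_surjective (s i)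
    refine ⟨σ, fun x => ?_⟩
    refine (map_sum (QuotientAddGroup.mk' (AddSubgroup.zmultiples (1 : ℝ))) _ _).trans ?_
    refine Finset.sum_congr rfl fun i _ => ?_
    rw [← hσ i]
    exact hHh _
  have hcont : ∀ (n : ℕ) (σ : ℕ → ℝ),
      Continuous fun x : ℝ => ∑ i ∈ Finset.range n, H (σ i + x) := fun n σ => by fun_prop
  rcases eq_or_ne k 0 with rfl | hk0
  -- In degree zero the average over `x` of the lifted sum is `n` times the integral of `H`, and a
  -- continuous function attains its average.
  · have hper : Function.Periodic H 1 := fun x => by simpa using hk x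
    refine ⟨((∫ x in (0 : ℝ)..1, H x : ℝ) : UnitAddCircle), fun n _ s => ?_⟩
    obtain ⟨σ, hσ⟩ := hlift n s
    obtain ⟨x, -, hx⟩ := exists_eq_const_mul_intervalIntegral_of_nonneg (a := (0 : ℝ)) (b := 1)
      (μ := MeasureTheory.volume) (g := fun _ => (1 : ℝ)) (hcont n σ).continuousOn
      intervalIntegrable_const (fun _ _ => zero_le_one)
    refine ⟨x, ?_⟩
    rw [← hσ x, ← AddCircle.coe_nsmul]
    congr 1
    simp only [mul_one, intervalIntegral.integral_const, sub_zero, smul_eq_mul] at hx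
    rw [← hx, intervalIntegral.integral_finsetSum fun i _ =>
      (show Continuous fun x => H (σ i + x) by fun_prop).intervalIntegrable _ _]
    have : ∀ i, ∫ x in (0 : ℝ)..1, H (σ i + x) = ∫ x in (0 : ℝ)..1, H x := by
      intro i
      rw [intervalIntegral.integral_comp_add_left (fun x => H x), add_zero]
      simpa using hper.intervalIntegral_add_eq (σ i) 0
    simp [this]
  -- In nonzero degree the lifted sum changes by `n * k`, a nonzero integer, over one period, so it
  -- passes through an integer.
  · refine ⟨0, fun n hn s => ?_⟩
    obtain ⟨σ, hσ⟩ := hlift n s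
    set F : ℝ → ℝ := fun x => ∑ i ∈ Finset.range n, H (σ i + x) with hF
    have hF1 : F 1 = F 0 + n * k := by
      simp only [hF, add_zero, hk, Finset.sum_add_distrib]
      simp
    suffices ∃ (x : ℝ) (m : ℤ), F x = m by
      obtain ⟨x, m, hx⟩ := this
      refine ⟨x, ?_⟩
      rw [← hσ x, smul_zero]
      change ((F x : ℝ) : UnitAddCircle) = 0
      rw [hx, UnitAddCircle.coe_intCast]
    have hnk : (n : ℤ) * k ≠ 0 := mul_ne_zero (by exact_mod_cast hn.ne') hk0
    rcases lt_or_gt_of_ne hnk with hneg | hpos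
    · have h1 : F 1 ≤ F 0 - 1 := by
        have : (n : ℝ) * k ≤ -1 := by exact_mod_cast (by omega : (n : ℤ) * k ≤ -1)
        linarith
      obtain ⟨x, -, hx⟩ := intermediate_value_Icc' zero_le_one (hcont n σ).continuousOn
        (show ((⌊F 0⌋ : ℤ) : ℝ) ∈ Set.Icc (F 1) (F 0) from
          ⟨by linarith [Int.lt_floor_add_one (F 0)], Int.floor_le _⟩)
      exact ⟨x, _, hx⟩
    · have h1 : F 0 + 1 ≤ F 1 := by
        have : (1 : ℝ) ≤ (n : ℝ) * k := by exact_mod_cast (by omega : 1 ≤ (n : ℤ) * k)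
        linarith
      obtain ⟨x, -, hx⟩ := intermediate_value_Icc zero_le_one (hcont n σ).continuousOn
        (show ((⌈F 0⌉ : ℤ) : ℝ) ∈ Set.Icc (F 0) (F 1) from
          ⟨Int.le_ceil _, by linarith [Int.ceil_lt_add_one (F 0)]⟩)
      exact ⟨x, _, hx⟩

/-! ### Iterates of the tower -/

section SkewTower

variable {X : Type*} {d : ℕ} (T : X → X) (h₁ : X → UnitAddCircle)

theorem skewTower_init (h : Fin (d + 1) → UnitAddCircle → UnitAddCircle)
    (p : X × (Fin (d + 2) → UnitAddCircle)) :
    ((skewTower T h₁ h p).1, Fin.init (skewTower T h₁ h p).2) =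
      skewTower T h₁ (fun i => h i.castSucc) (p.1, Fin.init p.2) := by
  refine Prod.ext rfl (funext fun i => ?_)
  refine Fin.cases rfl (fun i => rfl) i

theorem skewTower_iterate_init (h : Fin (d + 1) → UnitAddCircle → UnitAddCircle)
    (p : X × (Fin (d + 2) → UnitAddCircle)) (n : ℕ) :
    (((skewTower T h₁ h)^[n] p).1, Fin.init ((skewTower T h₁ h)^[n] p).2) =
      (skewTower T h₁ (fun i => h i.castSucc))^[n] (p.1, Fin.init p.2) := by
  induction n with
  | zero => rfl
  | succ n ih => rw [Function.iterate_succ_apply', skewTower_init, ih, Function.iterate_succ_apply']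

theorem skewTower_iterate_last (h : Fin (d + 1) → UnitAddCircle → UnitAddCircle)
    (p : X × (Fin (d + 2) → UnitAddCircle)) (n : ℕ) :
    ((skewTower T h₁ h)^[n] p).2 (Fin.last (d + 1)) = p.2 (Fin.last (d + 1)) +
      ∑ i ∈ Finset.range n, h (Fin.last d)
        (((skewTower T h₁ (fun i => h i.castSucc))^[i] (p.1, Fin.init p.2)).2 (Fin.last d)) := by
  induction n with
  | zero => simp
  | succ n ih =>
    rw [Function.iterate_succ_apply', Finset.sum_range_succ, ← add_assoc, ← ih,
      ← skewTower_iterate_init]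
    rfl

/-- The tower commutes with the translations of the last coordinate. -/
theorem skewTower_iterate_add_single_last (h : Fin d → UnitAddCircle → UnitAddCircle)
    (p : X × (Fin (d + 1) → UnitAddCircle)) (s : UnitAddCircle) (n : ℕ) :
    (skewTower T h₁ h)^[n] (p.1, p.2 + Pi.single (Fin.last d) s) =
      (((skewTower T h₁ h)^[n] p).1,
        ((skewTower T h₁ h)^[n] p).2 + Pi.single (Fin.last d) s) := by
  induction n with
  | zero => rfl
  | succ n ih =>
    rw [Function.iterate_succ_apply', ih, Function.iterate_succ_apply']
    generalize (skewTower T h₁ h)^[n] p = q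
    refine Prod.ext rfl (funext fun i => ?_)
    refine Fin.cases ?_ (fun i => ?_) i
    · simp only [skewTower, Fin.cons_zero, Pi.add_apply]
      abel
    · have : i.castSucc ≠ Fin.last d := (Fin.castSucc_lt_last i).ne
      simp only [skewTower, Fin.cons_succ, Pi.add_apply, Pi.single_eq_of_ne this, add_zero]
      abel

theorem skewTower_zero_iterate (h : Fin 0 → UnitAddCircle → UnitAddCircle)
    (p : X × (Fin 1 → UnitAddCircle)) (n : ℕ) :
    (skewTower T h₁ h)^[n] p =
      (T^[n] p.1, p.2 + fun _ => ∑ i ∈ Finset.range n, h₁ (T^[i] p.1)) := by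
  induction n with
  | zero => exact Prod.ext rfl (by ext; simp)
  | succ n ih =>
    rw [Function.iterate_succ_apply', ih, Function.iterate_succ_apply']
    refine Prod.ext rfl (funext fun i => ?_)
    obtain rfl : i = 0 := Subsingleton.elim (α := Fin 1) i 0
    simp only [skewTower, Fin.cons_zero, Pi.add_apply, Finset.sum_range_succ, add_assoc]

end SkewTower

/-! ### Induction on the height -/

/-- Adding one more skew product over the circle preserves Bohr₀ large returns. -/
theorem HasBohrZeroLargeReturns.skewTower_succ {X : Type*} [MetricSpace X] {T : X → X}
    {h₁ : X → UnitAddCircle} {d : ℕ} {h : Fin (d + 1) → UnitAddCircle → UnitAddCircle}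
    (hh : Continuous (h (Fin.last d)))
    (hd : HasBohrZeroLargeReturns (skewTower T h₁ fun i : Fin d => h i.castSucc)) :
    HasBohrZeroLargeReturns (skewTower T h₁ h) := by
  intro ε hε
  obtain ⟨c, hc⟩ := exists_forall_exists_sum_add_eq hh
  refine ((hd ε hε).inter (isBohrZero_norm_nsmul_lt c hε)).mono ?_
  rintro n ⟨⟨q, hq⟩, hn⟩
  set S := skewTower T h₁ fun i : Fin d => h i.castSucc
  obtain ⟨t, ht⟩ := hc n n.pos fun i => (S^[i] q).2 (Fin.last d)
  set q' : X × (Fin (d + 1) → UnitAddCircle) := (q.1, q.2 + Pi.single (Fin.last d) t)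
  have hq' : ∀ m, S^[m] q' = ((S^[m] q).1, (S^[m] q).2 + Pi.single (Fin.last d) t) :=
    skewTower_iterate_add_single_last T h₁ _ q t
  -- The displacement does not depend on the new coordinate, so `0` will do.
  refine ⟨(q'.1, Fin.snoc q'.2 0), ?_⟩
  have h1 := skewTower_iterate_init T h₁ h (q'.1, Fin.snoc q'.2 0) n
  have h2 := skewTower_iterate_last T h₁ h (q'.1, Fin.snoc q'.2 0) n
  rw [Fin.init_snoc] at h1 h2
  change _ = S^[n] q' at h1
  have h3 : ∑ i ∈ Finset.range n, h (Fin.last d) ((S^[i] q').2 (Fin.last d)) = (n : ℕ) • c := by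
    rw [← ht]
    refine Finset.sum_congr rfl fun i _ => ?_
    rw [hq' i]
    simp
  change _ = _ + ∑ i ∈ Finset.range n, h (Fin.last d) ((S^[i] q').2 (Fin.last d)) at h2
  simp only [h3, Fin.snoc_last, zero_add] at h2
  set r := (skewTower T h₁ h)^[n] (q'.1, Fin.snoc q'.2 0)
  rw [hq' n] at h1
  rw [Prod.dist_eq, max_lt_iff, dist_pi_lt_iff hε] at hq ⊢
  refine ⟨?_, fun i => ?_⟩
  · have : r.1 = (S^[n] q).1 := congrArg Prod.fst h1
    rw [this]
    exact hq.1
  · refine Fin.lastCases ?_ (fun i => ?_) i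
    · simp only [h2, Fin.snoc_last, dist_zero_left]
      exact hn
    · have : r.2 i.castSucc =
          (S^[n] q).2 i + (Pi.single (Fin.last d) t : Fin (d + 1) → UnitAddCircle) i :=
        congrFun (congrArg Prod.snd h1) i
      simp only [this, Fin.snoc_castSucc, q', Pi.add_apply, dist_add_right]
      exact hq.2 i

/-- The start `j` of a good window depends on `n`, so the almost periods of `y` must be uniform
along its orbit. -/
theorem hasBohrZeroLargeReturns_skewTower_zero {X : Type*} [MetricSpace X] [CompactSpace X]
    [Nonempty X] {T : X → X} (hTeq : UniformEquicontinuous (fun n : ℕ => T^[n]))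
    {h₁ : X → UnitAddCircle} (hh₁ : Continuous h₁) (h : Fin 0 → UnitAddCircle → UnitAddCircle) :
    HasBohrZeroLargeReturns (skewTower T h₁ h) := by
  intro ε hε
  obtain ⟨y, hy⟩ := exists_isBohrZero_dist_lt T hTeq
  have ha : ∀ η > 0, IsBohrZero {n : ℕ+ | ∀ j : ℕ, ‖h₁ (T^[j + n] y) - h₁ (T^[j] y)‖ < η} := by
    intro η hη
    obtain ⟨δ, hδ, h⟩ := Metric.uniformContinuous_iff.1
      (CompactSpace.uniformContinuous_of_continuous hh₁) η hη
    refine (hy δ hδ).mono fun n hn j => ?_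
    rw [← dist_eq_norm]
    exact h (hn j)
  refine ((hy ε hε).inter
    (isBohrZero_exists_norm_sum_lt (a := fun j => h₁ (T^[j] y)) ha hε)).mono ?_
  rintro n ⟨hn, j, hj⟩
  refine ⟨(T^[j] y, 0), ?_⟩
  rw [skewTower_zero_iterate, Prod.dist_eq, max_lt_iff, dist_pi_lt_iff hε]
  refine ⟨?_, fun i => ?_⟩
  · rw [← Function.iterate_add_apply, dist_comm, add_comm (n : ℕ)]
    exact hn j
  · simp only [zero_add, Pi.zero_apply, dist_zero_left, ← Function.iterate_add_apply]
    simpa only [add_comm j] using hj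

theorem theoremA {X : Type*} [MetricSpace X] [CompactSpace X] [Nonempty X]
    (T : X → X) (hT : Continuous T) (hTeq : UniformEquicontinuous (fun n : ℕ => T^[n]))
    (d : ℕ) (h₁ : X → UnitAddCircle) (hh₁ : Continuous h₁)
    (h : Fin d → UnitAddCircle → UnitAddCircle) (hh : ∀ i, Continuous (h i)) :
    (∀ R : Set ℕ+, IsSetOfBohrRecurrence R → IsSetOfRecurrenceFor R (skewTower T h₁ h)) ∧
      HasBohrZeroLargeReturns (skewTower T h₁ h) := by
  suffices H : HasBohrZeroLargeReturns (skewTower T h₁ h) from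
    ⟨fun R hR => H.isSetOfRecurrenceFor hR, H⟩
  induction d with
  | zero => exact hasBohrZeroLargeReturns_skewTower_zero hTeq hh₁ h
  | succ d ih => exact (ih _ fun i => hh i.castSucc).skewTower_succ (hh (Fin.last d))
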